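/- Let $\mathbb F$ be a perfect field, let $\mathfrak m$ be a maximal ideal of $\mathbb F[x_1,x_2]$, and let $I\subset\mathbb F[x_1,x_2]$ be a zero-dimensional $\mathfrak m$-primary ideal. Put $\deg(I)=\dim_{\mathbb F}\mathbb F[x_1,x_2]/I$, and assume that $\mathbb F$ has characteristic zero or characteristic at least $\deg(I)$. Let $\tilde{\mathfrak m}\subset\mathbb F[y_1,y_2]$ be the ideal $\mathfrak m$ with the variables renamed to $y_1,y_2$, let $\mathbb K=\mathbb F[y_1,y_2]/\tilde{\mathfrak m}$, and let $\alpha_1,\alpha_2\in\mathbb K$ be the residue classes of $y_1,y_2$. Let $I\cdot\mathbb K[\xi_1,\xi_2]$ be the ideal generated by the image of $I$ under $\mathbb F[x_1,x_2]\to\mathbb K[\xi_1,\xi_2]$, $(x_1,x_2)\mapsto(\xi_1,\xi_2)$. Then this ideal has exactly one primary component $J$ at $(\alpha_1,\alpha_2)$, that is, exactly one ideal with radical $\langle\xi_1-\alpha_1,\xi_2-\alpha_2\rangle$ that occurs in a minimal primary decomposition of $I\cdot\mathbb K[\xi_1,\xi_2]$. Let $J'$ be the image of $J$ under the $\mathbb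 K$-algebra automorphism $(\xi_1,\xi_2)\mapsto(\xi_1+\alpha_1,\xi_2+\alpha_2)$ of $\mathbb K[\xi_1,\xi_2]$. Then there is an isomorphism of $\mathbb F$-algebras $$\pi_{\mathfrak m,J'}:\ \mathbb F[x_1,x_2]/I\ \longrightarrow\ \mathbb K[\xi_1,\xi_2]/J'$$ that maps the classes of $x_1,x_2$ to the classes of $\xi_1+\alpha_1,\ \xi_2+\alpha_2$. -/

import Mathlib

noncomputable section

namespace Untangling

/-- The degree of an ideal `I` of `F[x₁, x₂]`: the dimension of `F[x₁, x₂]/I` over `F`. -/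
def degree {F : Type*} [Field F] (I : Ideal (MvPolynomial (Fin 2) F)) : ℕ :=
  Module.finrank F (MvPolynomial (Fin 2) F ⧸ I)

/-- The residue ring `𝕂 = F[y₁, y₂]/𝔪`, a field extension of `F` when `𝔪` is maximal. -/
abbrev ResidueField {F : Type*} [Field F] (m : Ideal (MvPolynomial (Fin 2) F)) : Type _ :=
  MvPolynomial (Fin 2) F ⧸ m

/-- The point `α = (α₁, α₂)`: the residue classes of the variables in `𝕂`. -/
def alpha {F : Type*} [Field F] (m : Ideal (MvPolynomial (Fin 2) F)) (i : Fin 2) :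
    ResidueField m :=
  Ideal.Quotient.mk m (MvPolynomial.X i)

/-- The natural embedding `F[x₁, x₂] → 𝕂[ξ₁, ξ₂]`, `xᵢ ↦ ξᵢ`. -/
def embed {F : Type*} [Field F] (m : Ideal (MvPolynomial (Fin 2) F)) :
    MvPolynomial (Fin 2) F →ₐ[F] MvPolynomial (Fin 2) (ResidueField m) :=
  MvPolynomial.aeval MvPolynomial.X

/-- The ideal `⟨ξ₁ - a₁, ξ₂ - a₂⟩` of the point `a = (a₁, a₂)`. -/
def pointIdeal {K : Type*} [CommRing K] (a : Fin 2 → K) : Ideal (MvPolynomial (Fin 2) K) :=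
  Ideal.span {MvPolynomial.X 0 - MvPolynomial.C (a 0), MvPolynomial.X 1 - MvPolynomial.C (a 1)}

/-- `J` is a primary component of the ideal `A` associated to `p`: it occurs, with radical `p`, in
some minimal primary decomposition of `A`. -/
def IsPrimaryComponent {R : Type*} [CommRing R] (A p J : Ideal R) : Prop :=
  ∃ t : Finset (Ideal R), Submodule.IsMinimalPrimaryDecomposition A t ∧ J ∈ t ∧ J.radical = p

/-- The substitution `ξᵢ ↦ ξᵢ + aᵢ`, an automorphism of `K[ξ₁, ξ₂]` over `K`. -/
def translation {K : Type*} [CommRing K] (a : Fin 2 → K) :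
    MvPolynomial (Fin 2) K ≃ₐ[K] MvPolynomial (Fin 2) K :=
  AlgEquiv.ofAlgHom
    (MvPolynomial.aeval fun i => MvPolynomial.X i + MvPolynomial.C (a i))
    (MvPolynomial.aeval fun i => MvPolynomial.X i - MvPolynomial.C (a i))
    (by ext i : 1; simp [MvPolynomial.algHom_C])
    (by ext i : 1; simp [MvPolynomial.algHom_C])

end Untangling

end

namespace Untangling

open MvPolynomial

/-! Perfectness makes the finite extension `K/F` separable, hence formally étale. The ring `F[x]/I`
has nilpotent maximal ideal and residue field `K`, so formal smoothness lifts `K` into it. This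
gives a ring map `ψ : K[ξ] → F[x]/I` fixing the variables and killing the extension of `I`
(`exists_retraction`). Injectivity: `J` consists of the `f` with `s * f` in the extension for some
`s` not vanishing at `α`, and `ψ s` is then a nonzerodivisor, so `J` contracts to `I`
(`comap_eq_of_mem_iff`). Surjectivity: formal unramifiedness makes the lift of `K` unique, so `K[ξ]
→ K[ξ]/J` factors through `ψ` (`mk_comp_map_surjective`). -/

/-- The component of `A` at a minimal prime `p` is the contraction of the localization of `A`
at `p`. -/
theorem IsPrimaryComponent.mem_iff {R : Type*} [CommRing R] {A p J : Ideal R}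
    (hp : p ∈ A.minimalPrimes) (hJ : IsPrimaryComponent A p J) (f : R) :
    f ∈ J ↔ ∃ s, s ∉ p ∧ s * f ∈ A := by
  classical
  obtain ⟨t, ht, hJt, hrad⟩ := hJ
  have hprime : p.IsPrime := hp.1.1
  constructor
  · intro hf
    -- Otherwise another component has radical inside `p`, hence equal to `p` by minimality, while
    -- the radicals in `t` are distinct.
    have hne : ¬ (t.erase J).inf id ≤ p := by
      intro hle
      obtain ⟨q, hq, hqp⟩ := (Ideal.IsPrime.inf_le' hprime).mp hle
      obtain ⟨hqJ, hqt⟩ := Finset.mem_erase.mp hq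
      have hqp' : q.radical ≤ p := hprime.radical_le_iff.mpr hqp
      have hAq : A ≤ q.radical :=
        (ht.inf_eq.symm.trans_le (Finset.inf_le hqt)).trans Ideal.le_radical
      have heq : q.radical = p :=
        le_antisymm hqp' (hp.2 ⟨Ideal.isPrime_radical (ht.primary hqt), hAq⟩ hqp')
      refine ht.distinct hqt hJt hqJ ?_
      simp [heq, hrad]
    obtain ⟨s, hs, hsp⟩ := SetLike.not_le_iff_exists.mp hne
    refine ⟨s, hsp, ?_⟩
    rw [← ht.inf_eq, ← Finset.insert_erase hJt, Finset.inf_insert]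
    exact ⟨J.mul_mem_left _ hf, Ideal.mul_mem_right _ _ hs⟩
  · rintro ⟨s, hs, hsf⟩
    have hsJ : s * f ∈ J := (ht.inf_eq.symm.trans_le (Finset.inf_le hJt)) hsf
    rw [mul_comm] at hsJ
    exact ((Ideal.isPrimary_iff.mp (ht.primary hJt)).2 hsJ).resolve_right (hrad ▸ hs)

theorem existsUnique_isPrimaryComponent {R : Type*} [CommRing R] [IsNoetherianRing R]
    {A p : Ideal R} (hp : p ∈ A.minimalPrimes) : ∃! J, IsPrimaryComponent A p J := by
  obtain ⟨t, ht⟩ := Submodule.IsLasker.exists_isMinimalPrimaryDecomposition (Submodule.isLasker R R) A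
  obtain ⟨J, hJt, hJ⟩ := Ideal.IsMinimalPrimaryDecomposition.minimalPrimes_subset_image_radical ht hp
  have hJ' : IsPrimaryComponent A p J := ⟨t, ht, hJt, hJ⟩
  refine ⟨J, hJ', fun J₂ hJ₂ => Ideal.ext fun f => ?_⟩
  rw [hJ₂.mem_iff hp, hJ'.mem_iff hp]

theorem pointIdeal_eq_ker {K : Type*} [CommRing K] (a : Fin 2 → K) :
    pointIdeal a = RingHom.ker (eval a) := by
  refine le_antisymm ?_ fun f hf => ?_
  · rw [pointIdeal, Ideal.span_le]
    rintro _ (rfl | rfl) <;> simp [RingHom.mem_ker]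
  -- Modulo the point ideal, every polynomial is congruent to its value at `a`.
  · have key : (Ideal.Quotient.mk (pointIdeal a)) =
        ((Ideal.Quotient.mk (pointIdeal a)).comp C).comp (eval a) := by
      refine MvPolynomial.ringHom_ext (by simp) fun i => ?_
      simp only [RingHom.comp_apply, eval_X]
      refine Ideal.Quotient.eq.mpr (Ideal.subset_span ?_)
      fin_cases i <;> simp
    rw [← Ideal.Quotient.eq_zero_iff_mem, key, RingHom.comp_apply, RingHom.mem_ker.mp hf, map_zero]

theorem isNilpotent_ker_lift {R S : Type*} [CommRing R] [IsNoetherianRing R] [CommRing S]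
    {J : Ideal R} (e : R →+* S) (hJ : J.radical = RingHom.ker e) (h : ∀ f ∈ J, e f = 0) :
    IsNilpotent (RingHom.ker (Ideal.Quotient.lift J e h)) := by
  obtain ⟨n, hn⟩ := J.exists_radical_pow_le_of_fg J.radical.fg_of_isNoetherianRing
  refine ⟨n, ?_⟩
  have hker : RingHom.ker (Ideal.Quotient.lift J e h) ≤ J.radical.map (Ideal.Quotient.mk J) := by
    intro x hx
    obtain ⟨f, rfl⟩ := Ideal.Quotient.mk_surjective x
    exact Ideal.mem_map_of_mem _ (hJ.ge hx)
  rw [Ideal.zero_eq_bot, eq_bot_iff]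
  refine (Ideal.pow_right_mono hker n).trans ?_
  rw [← Ideal.map_pow, le_bot_iff, Ideal.map_eq_bot_iff_le_ker, Ideal.mk_ker]
  exact hn

section Extension

variable {F K σ : Type*} [Field F] [Field K] [Algebra F K]

-- A prime between the extended ideal and the point ideal contracts to the maximal ideal
-- `I.radical`; since `K[ξ]` is integral over `F[x]`, it is itself maximal.
attribute [local instance] MvPolynomial.algebraMvPolynomial in
theorem map_mem_minimalPrimes [Algebra.IsIntegral F K] {a : σ → K}
    {I : Ideal (MvPolynomial σ F)} (hI : I.radical = RingHom.ker (aeval (R := F) a))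
    (hmax : I.radical.IsMaximal) :
    RingHom.ker (eval a) ∈ (I.map (map (algebraMap F K))).minimalPrimes := by
  refine ⟨⟨RingHom.ker_isPrime _, ?_⟩, ?_⟩
  · rw [Ideal.map_le_iff_le_comap]
    intro f hf
    have : aeval a f = 0 := hI.le (Ideal.le_radical hf)
    rw [Ideal.mem_comap, RingHom.mem_ker, eval_map]
    exact this
  · rintro P ⟨hP, hIP⟩ hle
    have hcomap : P.comap (map (algebraMap F K)) = I.radical :=
      (hmax.eq_of_le (Ideal.IsPrime.ne_top (Ideal.comap_isPrime _ _))
        ((Ideal.IsPrime.radical_le_iff (Ideal.comap_isPrime _ _)).mpr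
          (Ideal.map_le_iff_le_comap.mp hIP))).symm
    have hPmax : P.IsMaximal :=
      Ideal.isMaximal_of_isIntegral_of_isMaximal_comap' (map (algebraMap F K))
        (algebraMap_isIntegral_iff (R := MvPolynomial σ F) (A := MvPolynomial σ K) |>.mpr
          inferInstance) P
        (hcomap ▸ hmax)
    exact (hPmax.eq_of_le (RingHom.ker_isPrime _).ne_top hle).ge

/-- A coefficient field of the local ring `F[x]/I` makes it a quotient of `K[ξ]`. -/
theorem exists_retraction [Finite σ] [Algebra.FormallySmooth F K] {a : σ → K}
    {I : Ideal (MvPolynomial σ F)} (hI : I.radical = RingHom.ker (aeval (R := F) a))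
    (ha : Function.Surjective (aeval (R := F) a)) :
    ∃ ψ : MvPolynomial σ K →+* MvPolynomial σ F ⧸ I,
      ψ.comp (map (algebraMap F K)) = Ideal.Quotient.mk I ∧
      ∀ s f, ψ s = Ideal.Quotient.mk I f → aeval a f = eval a s := by
  have hle : ∀ f ∈ I, aeval (R := F) a f = 0 := fun f hf => hI.le (Ideal.le_radical hf)
  let p : (MvPolynomial σ F ⧸ I) →ₐ[F] K := Ideal.Quotient.liftₐ I (aeval a) hle
  have hp : ∀ f, p (Ideal.Quotient.mk I f) = aeval a f := fun f => rfl
  have hsurj : Function.Surjective p := fun x =>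
    let ⟨f, hf⟩ := ha x
    ⟨Ideal.Quotient.mk I f, hf⟩
  have hnil : IsNilpotent (RingHom.ker (p : (MvPolynomial σ F ⧸ I) →+* K)) := isNilpotent_ker_lift _ hI hle
  let c : K →ₐ[F] MvPolynomial σ F ⧸ I :=
    Algebra.FormallySmooth.liftOfSurjective (AlgHom.id F K) p hsurj hnil
  have hc : ∀ x, p (c x) = x := fun x =>
    Algebra.FormallySmooth.liftOfSurjective_apply (AlgHom.id F K) p hsurj hnil x
  let ψ : MvPolynomial σ K →+* MvPolynomial σ F ⧸ I :=
    eval₂Hom (c : K →+* MvPolynomial σ F ⧸ I) fun i => Ideal.Quotient.mk I (X i)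
  -- `c` is a section of the residue map `p`, so reducing `ψ s` recovers the value of `s` at `a`.
  have hψ : (p : (MvPolynomial σ F ⧸ I) →+* K).comp ψ = eval a := by
    refine MvPolynomial.ringHom_ext (fun x => ?_) fun i => ?_
    · simp [ψ, hc]
    · simp [ψ, hp]
  refine ⟨ψ, MvPolynomial.ringHom_ext (fun x => ?_) fun i => ?_, fun s f hsf => ?_⟩
  · simp only [RingHom.comp_apply, map_C, ψ, coe_eval₂Hom, eval₂_C]
    exact c.commutes x
  · simp [ψ]
  · rw [← hp, ← hsf, ← hψ]
    rfl

theorem comap_eq_of_mem_iff [Finite σ] [Algebra.FormallySmooth F K] {a : σ → K}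
    {I : Ideal (MvPolynomial σ F)} (hprim : I.IsPrimary)
    (hI : I.radical = RingHom.ker (aeval (R := F) a))
    (ha : Function.Surjective (aeval (R := F) a)) {J : Ideal (MvPolynomial σ K)}
    (hJ : ∀ f, f ∈ J ↔ ∃ s, s ∉ RingHom.ker (eval a) ∧ s * f ∈ I.map (map (algebraMap F K))) :
    J.comap (map (algebraMap F K)) = I := by
  refine le_antisymm (fun f hf => ?_) fun f hf => ?_
  · obtain ⟨ψ, hψ, hψa⟩ := exists_retraction hI ha
    obtain ⟨s, hs, hsf⟩ := (hJ _).mp (Ideal.mem_comap.mp hf)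
    obtain ⟨g, hg⟩ := Ideal.Quotient.mk_surjective (ψ s)
    have hle : I.map (map (algebraMap F K)) ≤ RingHom.ker ψ := by
      rw [Ideal.map_le_iff_le_comap, RingHom.comap_ker, hψ, Ideal.mk_ker]
    have h0 : ψ (s * map (algebraMap F K) f) = 0 := hle hsf
    rw [map_mul, ← hg, ← RingHom.comp_apply, hψ, ← map_mul, Ideal.Quotient.eq_zero_iff_mem,
      -- Now `f * g ∈ I` with `I` primary; `g ∈ I.radical` would force `s` to vanish at `a`.
      mul_comm] at h0
    refine ((Ideal.isPrimary_iff.mp hprim).2 h0).resolve_right fun hgI => hs ?_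
    rw [RingHom.mem_ker, ← hψa s g hg.symm]
    exact hI.le hgI
  · exact (hJ _).mpr ⟨1, by simp [RingHom.mem_ker],
      by rw [one_mul]; exact Ideal.mem_map_of_mem _ hf⟩

theorem mk_comp_map_surjective [Finite σ] [Algebra.FormallyEtale F K] {a : σ → K}
    {I : Ideal (MvPolynomial σ F)} (hI : I.radical = RingHom.ker (aeval (R := F) a))
    (ha : Function.Surjective (aeval (R := F) a)) {J : Ideal (MvPolynomial σ K)}
    (hIJ : I.map (map (algebraMap F K)) ≤ J) (hJ : J.radical = RingHom.ker (eval a)) :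
    Function.Surjective ((Ideal.Quotient.mk J).comp (map (algebraMap F K))) := by
  obtain ⟨ψ, hψ, hψa⟩ := exists_retraction hI ha
  let u : MvPolynomial σ F ⧸ I →+* MvPolynomial σ K ⧸ J :=
    Ideal.quotientMap J (map (algebraMap F K)) (Ideal.map_le_iff_le_comap.mp hIJ)
  have hu : ∀ f, u (Ideal.Quotient.mk I f) = Ideal.Quotient.mk J (map (algebraMap F K) f) :=
    fun f => rfl
  let g₁ : K →ₐ[F] MvPolynomial σ K ⧸ J := IsScalarTower.toAlgHom F K _
  let g₂ : K →ₐ[F] MvPolynomial σ K ⧸ J :=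
    { (u.comp ψ).comp C with
      commutes' := fun x => by
        have : ψ (C (algebraMap F K x)) = Ideal.Quotient.mk I (C x) := by
          rw [← hψ]; simp
        change u (ψ (C (algebraMap F K x))) = _
        rw [this, hu, map_C]
        rfl }
  have hg₂ : ∀ x, g₂ x = u (ψ (C x)) := fun x => rfl
  have hJa : ∀ f ∈ J, eval a f = 0 := fun f hf => hJ.le (Ideal.le_radical hf)
  let q : MvPolynomial σ K ⧸ J →+* K := Ideal.Quotient.lift J (eval a) hJa
  have hnil : IsNilpotent (RingHom.ker q) := isNilpotent_ker_lift _ hJ hJa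
  -- The structure map and the lift through `ψ` agree modulo the nilpotent kernel of `q`, hence
  -- coincide.
  have hg : g₁ = g₂ := by
    refine Algebra.FormallyUnramified.ext' q hnil g₁ g₂ fun x => ?_
    obtain ⟨f, hf⟩ := Ideal.Quotient.mk_surjective (ψ (C x))
    rw [hg₂, ← hf, hu]
    change eval a (C x) = eval a (map (algebraMap F K) f)
    rw [← hψa _ f hf.symm, eval_map]
    rfl
  have hrange : (Ideal.Quotient.mk J) = u.comp ψ := by
    refine MvPolynomial.ringHom_ext (fun x => ?_) fun i => ?_
    · exact DFunLike.congr_fun hg x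
    · have : ψ (X i) = Ideal.Quotient.mk I (X i) := by rw [← hψ]; simp
      rw [RingHom.comp_apply, this, hu, map_X]
  intro y
  obtain ⟨h, rfl⟩ := Ideal.Quotient.mk_surjective y
  obtain ⟨f, hf⟩ := Ideal.Quotient.mk_surjective (ψ h)
  refine ⟨f, ?_⟩
  rw [RingHom.comp_apply, ← hu, hf, hrange, RingHom.comp_apply]

end Extension

theorem embed_eq_map {F : Type*} [Field F] (m : Ideal (MvPolynomial (Fin 2) F)) :
    (embed m : MvPolynomial (Fin 2) F →+* MvPolynomial (Fin 2) (ResidueField m)) =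
      map (algebraMap F (ResidueField m)) := by
  refine MvPolynomial.ringHom_ext (fun x => ?_) fun i => ?_
  · simp [embed]
  · simp [embed]

theorem isPrimaryComponent_le {R : Type*} [CommRing R] {A p J : Ideal R}
    (hJ : IsPrimaryComponent A p J) : A ≤ J :=
  let ⟨_, ht, hJt, _⟩ := hJ
  ht.inf_eq.symm.trans_le (Finset.inf_le hJt)

/-- An algebra map inducing an isomorphism modulo `J` induces one modulo the image of `J` under
an automorphism. -/
theorem exists_quotient_algEquiv {F A B : Type*} [CommRing F] [CommRing A] [CommRing B]
    [Algebra F A] [Algebra F B] (e : A →ₐ[F] B) (τ : B ≃+* B)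
    (hτ : ∀ r, τ (algebraMap F B r) = algebraMap F B r) {I : Ideal A} {J J' : Ideal B}
    (hJ' : J' = J.map τ) (hI : J.comap e = I)
    (hs : Function.Surjective ((Ideal.Quotient.mk J).comp (e : A →+* B))) :
    ∃ π : (A ⧸ I) ≃ₐ[F] (B ⧸ J'),
      ∀ x, π (Ideal.Quotient.mk I x) = Ideal.Quotient.mk J' (τ (e x)) := by
  -- Bijectivity of `τ` makes the ideal generated by the image of `J` equal to that image.
  have hmem : ∀ b, τ b ∈ J' ↔ b ∈ J := fun b => by
    rw [hJ']
    refine ⟨fun h => ?_, fun h => Ideal.mem_map_of_mem _ h⟩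
    obtain ⟨c, hc, hcb⟩ := (Ideal.mem_map_of_equiv τ _).mp h
    exact τ.injective hcb ▸ hc
  let φ : A →ₐ[F] B ⧸ J' :=
    (Ideal.Quotient.mkₐ F J').comp (AlgHom.comp { (τ : B →+* B) with commutes' := hτ } e)
  have hφ : ∀ x, φ x = Ideal.Quotient.mk J' (τ (e x)) := fun x => rfl
  have hker : ∀ x, φ x = 0 ↔ x ∈ I := fun x => by
    rw [hφ, Ideal.Quotient.eq_zero_iff_mem, hmem, ← hI, Ideal.mem_comap]
  refine ⟨AlgEquiv.ofBijective (Ideal.Quotient.liftₐ I φ fun x hx => (hker x).mpr hx) ⟨?_, ?_⟩,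
    fun x => rfl⟩
  · rw [injective_iff_map_eq_zero]
    intro y hy
    obtain ⟨x, rfl⟩ := Ideal.Quotient.mk_surjective y
    exact Ideal.Quotient.eq_zero_iff_mem.mpr ((hker x).mp hy)
  · intro y
    obtain ⟨z, rfl⟩ := Ideal.Quotient.mk_surjective y
    obtain ⟨w, rfl⟩ := τ.surjective z
    obtain ⟨x, hx⟩ := hs (Ideal.Quotient.mk J w)
    refine ⟨Ideal.Quotient.mk I x, ?_⟩
    change Ideal.Quotient.mk J' (τ (e x)) = _
    rw [Ideal.Quotient.eq, ← map_sub, hmem]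
    exact Ideal.Quotient.eq.mp hx

theorem aeval_alpha {F : Type*} [Field F] (m : Ideal (MvPolynomial (Fin 2) F)) :
    aeval (alpha m) = Ideal.Quotient.mkₐ F m := by
  ext i
  simp [alpha]

end Untangling

theorem proposition3 {F : Type*} [Field F] [PerfectField F]
    (m I : Ideal (MvPolynomial (Fin 2) F))
    (hm : m.IsMaximal) (hI : I.IsPrimary) (hIm : I.radical = m)
    (hdim : ringKrullDim (MvPolynomial (Fin 2) F ⧸ I) = 0)
    (hchar : ringChar F = 0 ∨ Untangling.degree I ≤ ringChar F) :
    (∃! J : Ideal (MvPolynomial (Fin 2) (Untangling.ResidueField m)),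
      Untangling.IsPrimaryComponent (I.map (Untangling.embed m))
        (Untangling.pointIdeal (Untangling.alpha m)) J) ∧
    ∀ J : Ideal (MvPolynomial (Fin 2) (Untangling.ResidueField m)),
      Untangling.IsPrimaryComponent (I.map (Untangling.embed m))
        (Untangling.pointIdeal (Untangling.alpha m)) J →
      ∃ π : (MvPolynomial (Fin 2) F ⧸ I) ≃ₐ[F]
          (MvPolynomial (Fin 2) (Untangling.ResidueField m) ⧸
            J.map (Untangling.translation (Untangling.alpha m))),
        ∀ i : Fin 2, π (Ideal.Quotient.mk I (MvPolynomial.X i)) =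
          Ideal.Quotient.mk (J.map (Untangling.translation (Untangling.alpha m)))
            (MvPolynomial.X i + MvPolynomial.C (Untangling.alpha m i)) := by
  let := Ideal.Quotient.field m
  have hfin : Module.Finite F (Untangling.ResidueField m) :=
    finite_of_finite_type_of_isJacobsonRing F (Untangling.ResidueField m)
  have : Algebra.FormallyEtale F (Untangling.ResidueField m) :=
    Algebra.FormallyEtale.of_isSeparable F (Untangling.ResidueField m)
  have hα := Untangling.aeval_alpha m
  have hker : I.radical = RingHom.ker (MvPolynomial.aeval (R := F) (Untangling.alpha m)) := by
    rw [hα, hIm]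
    exact Ideal.mk_ker.symm
  have hsurj : Function.Surjective (MvPolynomial.aeval (R := F) (Untangling.alpha m)) := by
    rw [hα]
    exact Ideal.Quotient.mk_surjective
  have hmap : I.map (Untangling.embed m) =
      I.map (MvPolynomial.map (algebraMap F (Untangling.ResidueField m))) := by
    rw [← Untangling.embed_eq_map]
    rfl
  have hmin := Untangling.map_mem_minimalPrimes hker (hIm.symm ▸ hm)
  rw [hmap, Untangling.pointIdeal_eq_ker]
  refine ⟨Untangling.existsUnique_isPrimaryComponent hmin, fun J hJ => ?_⟩
  have hcomap := Untangling.comap_eq_of_mem_iff hI hker hsurj (hJ.mem_iff hmin)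
  have hsur := Untangling.mk_comp_map_surjective hker hsurj
    (Untangling.isPrimaryComponent_le hJ) (let ⟨_, _, _, h⟩ := hJ; h)
  rw [← Untangling.embed_eq_map] at hcomap hsur
  obtain ⟨π, hπ⟩ := Untangling.exists_quotient_algEquiv (Untangling.embed m)
    (Untangling.translation (Untangling.alpha m)).toRingEquiv
    (fun r => ((Untangling.translation (Untangling.alpha m)).restrictScalars F).commutes r)
    (J' := J.map (Untangling.translation (Untangling.alpha m))) rfl hcomap hsur
  refine ⟨π, fun i => (hπ _).trans ?_⟩
  simp [Untangling.embed, Untangling.translation]
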